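/- For $x\in\mathbb R$ let $\mathrm{Ai}(x)=\frac1\pi\int_0^\infty\cos\left(\frac{t^3}{3}+xt\right)dt$ be the Airy function of the first kind, where the integral is the limit of $\int_0^R$ as $R\to\infty$, which exists for every $x$. The real zeros of $\mathrm{Ai}$ form an infinite, strictly decreasing sequence $-\alpha_1>-\alpha_2>\cdots$. Let $\|\cdot\|_2$ be the norm of $L^2(0,\infty)$ and put $$\psi_n(x)=\frac{\mathrm{Ai}(x-\alpha_n)}{\|\mathrm{Ai}(\cdot-\alpha_n)\|_2},\qquad n=1,2,\ldots$$ Then the following hold. 1. For all $n\ge1$, $\mathrm{Ai}(\cdot-\alpha_n)\in L^2(0,\infty)$, $\mathrm{Ai}$ is differentiable at $-\alpha_n$, and $\|\mathrm{Ai}(\cdot-\alpha_n)\|_2=|\mathrm{Ai}'(-\alpha_n)|$. Moreover, $\psi_n'(0)=(-1)^{n+1}$ for all $n\ge1$; in particular $|\psi_n'(0)|=1$ and $\psi_1'(0)=1$. 2. $\alpha_n n^{-2/3}\to(3\pi/2)^{2/3}$ as $n\to\infty$. 3. $|\psi_n(x)|\le x$ for all $n\ge1$ and $x\ge0$. 4.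 There is a constant $C$ such that for all $n\ge1$ the function $x\mapsto x|\psi_n(x)|$ is integrable on $(0,\infty)$ and $\int_0^\infty|\psi_n(x)|\,x\,dx\le C\,n^{4/3}$. -/

import Mathlib

open Filter Topology MeasureTheory Set

noncomputable section

/-- The truncated integral `(1/π) ∫₀ᴿ cos(t³/3 + x t) dt`. -/
def airyTrunc (x R : ℝ) : ℝ :=
  (1 / Real.pi) * ∫ t in (0 : ℝ)..R, Real.cos (t ^ 3 / 3 + x * t)

/-- The Airy function of the first kind,
`Ai(x) = (1/π) ∫₀^∞ cos(t³/3 + x t) dt`. The integral converges only conditionally, so it is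
the limit of the integrals over `[0, R]` as `R → ∞`. -/
def airyAi (x : ℝ) : ℝ :=
  limUnder atTop (airyTrunc x)

/-- `-airyAlpha 1 > -airyAlpha 2 > ⋯` are the real zeros of `Ai` in decreasing order:
`airyAlpha 1` is the least `a` with `Ai(-a) = 0`, and `airyAlpha (n + 1)` is the least such `a`
above `airyAlpha n`. The value at the index `0` is not used. -/
def airyAlpha : ℕ → ℝ
  | 0 => 0
  | 1 => sInf {a : ℝ | airyAi (-a) = 0}
  | n + 2 => sInf {a : ℝ | airyAlpha (n + 1) < a ∧ airyAi (-a) = 0}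

/-- The norm of `Ai(· - αₙ)` in `L²(0, ∞)`, as an extended nonnegative number. -/
def airyNorm (n : ℕ) : ENNReal :=
  eLpNorm (fun x : ℝ => airyAi (x - airyAlpha n)) 2 (volume.restrict (Ioi (0 : ℝ)))

/-- The normalized Airy eigenfunction `ψₙ(x) = Ai(x - αₙ) / ‖Ai(· - αₙ)‖₂`, for `n ≥ 1`. -/
def airyPsi (n : ℕ) (x : ℝ) : ℝ :=
  airyAi (x - airyAlpha n) / (airyNorm n).toReal

end

/-! Moving the contour to `Im z = η > 0` turns the conditionally convergent integral into one with
Gaussian decay. The line `η = 1` allows differentiation under the integral, hence `Ai'' = x Ai` and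
`O(exp (-x))` bounds for `Ai` and `Ai'`. The line `η = √x` passes through the saddle point and gives
`Ai x > 0` for `x ≥ 1`; the equation extends this to `x ≥ 0` (`airyAi_pos_of_nonneg`).

The energy `E = Ai'² - x Ai²` has `E' = -Ai²` and tends to `0` at infinity, so `‖Ai(· - a)‖₂² =
E(-a)`, which is `Ai'(-a)²` at a zero. Positivity of `E` makes the zeros simple, so the sign of `Ai`
alternates between them.

Sturm comparison of `u'' = -x u` with sines gives `π / √αₙ₊₁ ≤ αₙ₊₁ - αₙ ≤ π / √αₙ`. Hence the
increments of `αₙ^(3/2)` tend to `3π/2`, and Cesàro means give the asymptotics.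

Since `E` decreases, `|Ai'|` on `[-αₙ, ∞)` is largest at `-αₙ`, so the mean value inequality yields
`|ψₙ(x)| ≤ x`. For the moment, the normalization controls `(0, αₙ]` and exponential decay controls
the rest; the total is `O(αₙ²)`. -/

/-! ### Contour shift -/

/-- The integrand of the contour integral for the Airy function. -/
noncomputable def airyKernel (x : ℝ) (z : ℂ) : ℂ :=
  Complex.exp (Complex.I * (z ^ 3 / 3 + x * z))

lemma airyKernel_exponent (x t η : ℝ) :
    Complex.I * (((t : ℂ) + η * Complex.I) ^ 3 / 3 + x * ((t : ℂ) + η * Complex.I)) =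
      ((-η * t ^ 2 + η ^ 3 / 3 - x * η : ℝ) : ℂ) +
        ((t ^ 3 / 3 - η ^ 2 * t + x * t : ℝ) : ℂ) * Complex.I := by
  have h2 : Complex.I ^ 2 = -1 := Complex.I_sq
  have h3 : Complex.I ^ 3 = -Complex.I := by rw [pow_succ, h2]; ring
  have h4 : Complex.I ^ 4 = 1 := by rw [show 4 = 2 * 2 from rfl, pow_mul, h2]; norm_num
  push_cast
  ring_nf
  rw [h2, h3, h4]
  ring

lemma norm_airyKernel (x t η : ℝ) :
    ‖airyKernel x ((t : ℂ) + η * Complex.I)‖ =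
      Real.exp (-η * t ^ 2 + η ^ 3 / 3 - x * η) := by
  rw [airyKernel, airyKernel_exponent, Complex.norm_exp]
  simp only [Complex.add_re, Complex.ofReal_re, Complex.re_ofReal_mul, Complex.I_re, mul_zero,
    add_zero]

lemma re_airyKernel (x t η : ℝ) :
    (airyKernel x ((t : ℂ) + η * Complex.I)).re =
      Real.exp (-η * t ^ 2 + η ^ 3 / 3 - x * η) *
        Real.cos (t ^ 3 / 3 - η ^ 2 * t + x * t) := by
  rw [airyKernel, airyKernel_exponent, Complex.exp_re]
  simp only [Complex.add_re, Complex.ofReal_re, Complex.re_ofReal_mul, Complex.I_re, mul_zero,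
    add_zero, Complex.add_im, Complex.ofReal_im, Complex.im_ofReal_mul, Complex.I_im, mul_one,
    zero_add]

/-- Removes the contribution of the imaginary axis, both to the contour shift and to the boundary
term in the Airy equation. -/
lemma im_airyKernel_mul_I (x η : ℝ) : (airyKernel x (η * Complex.I)).im = 0 := by
  have h := airyKernel_exponent x 0 η
  simp only [Complex.ofReal_zero, zero_add] at h
  rw [airyKernel, h, Complex.exp_im]
  simp only [Complex.add_im, Complex.ofReal_im, Complex.im_ofReal_mul, Complex.I_im, mul_one,
    zero_add]
  norm_num

lemma re_airyKernel_ofReal (x t : ℝ) :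
    (airyKernel x t).re = Real.cos (t ^ 3 / 3 + x * t) := by
  simpa using re_airyKernel x t 0

lemma hasDerivAt_airyKernel (x : ℝ) (z : ℂ) :
    HasDerivAt (airyKernel x) (Complex.I * (z ^ 2 + x) * airyKernel x z) z := by
  have h : HasDerivAt (fun z : ℂ => Complex.I * (z ^ 3 / 3 + x * z))
      (Complex.I * (z ^ 2 + x)) z := by
    have := (((hasDerivAt_id z).pow 3).div_const 3).add ((hasDerivAt_id z).const_mul (x : ℂ))
    refine (this.const_mul Complex.I).congr_deriv ?_
    simp
  exact h.cexp.congr_deriv (mul_comm _ _)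

lemma continuous_airyKernel (x : ℝ) : Continuous (airyKernel x) := by
  unfold airyKernel; fun_prop

lemma integrable_gaussian_const {η : ℝ} (hη : 0 < η) (c : ℝ) :
    Integrable (fun t : ℝ => Real.exp (-η * t ^ 2 + c)) := by
  simpa only [Real.exp_add] using (integrable_exp_neg_mul_sq hη).mul_const (Real.exp c)

lemma integrable_airyKernel (x : ℝ) {η : ℝ} (hη : 0 < η) :
    Integrable (fun t : ℝ => airyKernel x ((t : ℂ) + η * Complex.I)) := by
  refine (integrable_gaussian_const hη (η ^ 3 / 3 - x * η)).mono' ?_ ?_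
  · exact ((continuous_airyKernel x).comp (by fun_prop)).aestronglyMeasurable
  · refine Eventually.of_forall fun t => ?_
    rw [norm_airyKernel, add_sub_assoc]

/-- The factor `exp (-y R²)` gives pointwise decay for `y > 0`; the modulus at `R = 0` dominates. -/
lemma tendsto_airyKernel_vertical (x : ℝ) {η : ℝ} (hη : 0 < η) :
    Tendsto (fun R : ℝ => ∫ y in (0 : ℝ)..η, airyKernel x ((R : ℂ) + y * Complex.I))
      atTop (𝓝 0) := by
  have hlim := intervalIntegral.tendsto_integral_filter_of_dominated_convergence
    (μ := volume) (a := 0) (b := η) (l := (atTop : Filter ℝ)) (f := fun _ : ℝ => (0 : ℂ))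
    (F := fun (R y : ℝ) => airyKernel x ((R : ℂ) + y * Complex.I))
    (fun y : ℝ => Real.exp (y ^ 3 / 3 - x * y)) ?_ ?_ ?_ ?_
  · simpa using hlim
  · exact Eventually.of_forall fun R =>
      ((continuous_airyKernel x).comp (by fun_prop)).aestronglyMeasurable
  · refine Eventually.of_forall fun R => Eventually.of_forall fun y hy => ?_
    rw [uIoc_of_le hη.le] at hy
    rw [norm_airyKernel, add_sub_assoc]
    apply Real.exp_le_exp.2
    nlinarith [mul_nonneg hy.1.le (sq_nonneg R)]
  · exact (Continuous.intervalIntegrable (by fun_prop) _ _)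
  · refine Eventually.of_forall fun y hy => ?_
    rw [uIoc_of_le hη.le] at hy
    rw [tendsto_zero_iff_norm_tendsto_zero]
    simp only [norm_airyKernel]
    refine Real.tendsto_exp_atBot.comp ?_
    have h1 : Tendsto (fun R : ℝ => -y * R ^ 2) atTop atBot := by
      simp only [neg_mul]
      exact tendsto_neg_atTop_atBot.comp
        ((tendsto_pow_atTop two_ne_zero).const_mul_atTop hy.1)
    simpa only [add_sub_assoc] using tendsto_atBot_add_const_right _ (y ^ 3 / 3 - x * y) h1

lemma airyTrunc_eq_contour (x R η : ℝ) :
    airyTrunc x R = (1 / Real.pi) *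
      ((∫ t in (0 : ℝ)..R, airyKernel x ((t : ℂ) + η * Complex.I)).re -
        (Complex.I * ∫ y in (0 : ℝ)..η, airyKernel x ((R : ℂ) + y * Complex.I)).re) := by
  have hrect := Complex.integral_boundary_rect_eq_zero_of_differentiableOn (airyKernel x)
    0 ((R : ℂ) + η * Complex.I)
    (fun z _ => (hasDerivAt_airyKernel x z).differentiableAt.differentiableWithinAt)
  simp only [Complex.zero_re, Complex.zero_im, Complex.add_re, Complex.add_im,
    Complex.ofReal_re, Complex.ofReal_im, Complex.re_ofReal_mul, Complex.im_ofReal_mul,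
    Complex.I_re, Complex.I_im, mul_zero, mul_one, add_zero, zero_add, Complex.ofReal_zero,
    zero_mul, smul_eq_mul] at hrect
  have hbase : (∫ t in (0 : ℝ)..R, airyKernel x (t : ℂ)).re =
      ∫ t in (0 : ℝ)..R, Real.cos (t ^ 3 / 3 + x * t) := by
    have h := Complex.reCLM.intervalIntegral_comp_comm (μ := volume) (a := 0) (b := R)
      (f := fun t : ℝ => airyKernel x (t : ℂ))
      (((continuous_airyKernel x).comp Complex.continuous_ofReal).intervalIntegrable _ _)
    simp only [Complex.reCLM_apply, re_airyKernel_ofReal] at h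
    exact h.symm
  have hleft : (Complex.I * ∫ y in (0 : ℝ)..η, airyKernel x (y * Complex.I)).re = 0 := by
    have h := Complex.imCLM.intervalIntegral_comp_comm (μ := volume) (a := 0) (b := η)
      (f := fun y : ℝ => airyKernel x (y * Complex.I))
      (((continuous_airyKernel x).comp (by fun_prop)).intervalIntegrable _ _)
    simp only [Complex.imCLM_apply, im_airyKernel_mul_I, intervalIntegral.integral_zero] at h
    rw [Complex.I_mul_re, ← h, neg_zero]
  have hre := congrArg Complex.re hrect
  simp only [Complex.sub_re, Complex.add_re, Complex.zero_re] at hre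
  rw [hleft, hbase] at hre
  rw [airyTrunc]
  congr 1
  linarith

lemma tendsto_airyTrunc_contour (x : ℝ) {η : ℝ} (hη : 0 < η) :
    Tendsto (airyTrunc x) atTop
      (𝓝 ((1 / Real.pi) * (∫ t in Ioi (0 : ℝ), airyKernel x ((t : ℂ) + η * Complex.I)).re)) := by
  have h1 := intervalIntegral_tendsto_integral_Ioi (μ := volume) (0 : ℝ)
    (integrable_airyKernel x hη).integrableOn (tendsto_id (α := ℝ) (x := atTop))
  have h2 := (tendsto_airyKernel_vertical x hη).const_mul Complex.I
  have h3 := ((Complex.continuous_re.tendsto _).comp h1).sub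
    ((Complex.continuous_re.tendsto _).comp h2)
  have h4 := h3.const_mul (1 / Real.pi)
  simp only [mul_zero, Complex.zero_re, sub_zero] at h4
  refine h4.congr fun R => ?_
  rw [airyTrunc_eq_contour x R η]
  rfl

lemma airyAi_eq_contour (x : ℝ) {η : ℝ} (hη : 0 < η) :
    airyAi x =
      (1 / Real.pi) * (∫ t in Ioi (0 : ℝ), airyKernel x ((t : ℂ) + η * Complex.I)).re :=
  (tendsto_airyTrunc_contour x hη).limUnder_eq

lemma tendsto_airyTrunc (x : ℝ) : Tendsto (airyTrunc x) atTop (𝓝 (airyAi x)) := by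
  rw [airyAi_eq_contour x one_pos]
  exact tendsto_airyTrunc_contour x one_pos

lemma airyAi_eq_gaussian (x : ℝ) {η : ℝ} (hη : 0 < η) :
    airyAi x = (1 / Real.pi) * ∫ t in Ioi (0 : ℝ), Real.exp (-η * t ^ 2 + η ^ 3 / 3 - x * η) *
        Real.cos (t ^ 3 / 3 - η ^ 2 * t + x * t) := by
  rw [airyAi_eq_contour x hη]
  have h := Complex.reCLM.integral_comp_comm (μ := volume.restrict (Ioi (0 : ℝ)))
    (φ := fun t : ℝ => airyKernel x ((t : ℂ) + η * Complex.I))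
    (integrable_airyKernel x hη).integrableOn
  simp only [Complex.reCLM_apply, re_airyKernel] at h
  rw [h]

/-! ### Differentiation under the integral and the Airy equation -/

/-- The integrand of the `k`-th derivative of the Airy integral along the line `Im z = 1`. -/
noncomputable def airyMomentKernel (k : ℕ) (x t : ℝ) : ℂ :=
  (Complex.I * ((t : ℂ) + (1 : ℝ) * Complex.I)) ^ k * airyKernel x ((t : ℂ) + (1 : ℝ) * Complex.I)

/-- The `k`-th derivative of the complex Airy integral along the line `Im z = 1`. -/
noncomputable def airyMoment (k : ℕ) (x : ℝ) : ℂ :=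
  ∫ t in Ioi (0 : ℝ), airyMomentKernel k x t

lemma continuous_airyMomentKernel (k : ℕ) (x : ℝ) : Continuous (airyMomentKernel k x) := by
  unfold airyMomentKernel airyKernel; fun_prop

lemma norm_airyMomentKernel_le (k : ℕ) (x t : ℝ) :
    ‖airyMomentKernel k x t‖ ≤ k.factorial * Real.exp (-(1 / 2) * t ^ 2 + (3 - x)) := by
  have h1 : ‖Complex.I * ((t : ℂ) + (1 : ℝ) * Complex.I)‖ ≤ |t| + 1 := by
    rw [norm_mul, Complex.norm_I, one_mul]
    refine (norm_add_le _ _).trans ?_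
    simp
  have h2 : (|t| + 1) ^ k ≤ k.factorial * Real.exp (|t| + 1) := by
    have := Real.pow_div_factorial_le_exp (|t| + 1) (by positivity) k
    rwa [div_le_iff₀' (by positivity)] at this
  rw [airyMomentKernel, norm_mul, norm_pow, norm_airyKernel]
  calc _ ≤ (k.factorial * Real.exp (|t| + 1)) *
        Real.exp (-1 * t ^ 2 + 1 ^ 3 / 3 - x * 1) := by
        gcongr
        exact (pow_le_pow_left₀ (norm_nonneg _) h1 k).trans h2
    _ = k.factorial * Real.exp (|t| + 1 + (-1 * t ^ 2 + 1 ^ 3 / 3 - x * 1)) := by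
        rw [Real.exp_add (|t| + 1)]; ring
    _ ≤ _ := by
        refine mul_le_mul_of_nonneg_left (Real.exp_le_exp.2 ?_) (by positivity)
        -- Half of the Gaussian absorbs `exp |t|`, by `|t| ≤ (t² + 1) / 2`.
        nlinarith [sq_nonneg (|t| - 1), sq_abs t]

lemma integrable_airyMomentKernel (k : ℕ) (x : ℝ) : Integrable (airyMomentKernel k x) :=
  ((integrable_gaussian_const one_half_pos (3 - x)).const_mul (k.factorial : ℝ)).mono'
    (continuous_airyMomentKernel k x).aestronglyMeasurable
    (Eventually.of_forall (norm_airyMomentKernel_le k x))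

lemma hasDerivAt_airyMomentKernel (k : ℕ) (x t : ℝ) :
    HasDerivAt (fun x => airyMomentKernel k x t) (airyMomentKernel (k + 1) x t) x := by
  unfold airyMomentKernel airyKernel
  set z : ℂ := (t : ℂ) + (1 : ℝ) * Complex.I
  have h : HasDerivAt (fun x : ℝ => Complex.I * (z ^ 3 / 3 + x * z)) (Complex.I * z) x := by
    have := (((Complex.ofRealCLM.hasDerivAt (x := x)).mul_const z).const_add (z ^ 3 / 3)).const_mul
      Complex.I
    simpa using this
  refine (h.cexp.const_mul ((Complex.I * z) ^ k)).congr_deriv ?_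
  ring

lemma hasDerivAt_airyMoment (k : ℕ) (x : ℝ) :
    HasDerivAt (airyMoment k) (airyMoment (k + 1) x) x := by
  refine (hasDerivAt_integral_of_dominated_loc_of_deriv_le (μ := volume.restrict (Ioi (0 : ℝ)))
    (F := airyMomentKernel k) (F' := airyMomentKernel (k + 1)) (x₀ := x)
    (bound := fun t => (k + 1).factorial * Real.exp (-(1 / 2) * t ^ 2 + (3 - (x - 1))))
    (Metric.ball_mem_nhds x one_pos) ?_ ?_ ?_ ?_ ?_ ?_).2
  · exact Eventually.of_forall fun y => (continuous_airyMomentKernel k y).aestronglyMeasurable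
  · exact (integrable_airyMomentKernel k x).integrableOn
  · exact (continuous_airyMomentKernel (k + 1) x).aestronglyMeasurable
  · refine Eventually.of_forall fun t y hy => (norm_airyMomentKernel_le (k + 1) y t).trans ?_
    rw [Real.ball_eq_Ioo] at hy
    gcongr
    exact hy.1.le
  · exact ((integrable_gaussian_const one_half_pos _).const_mul _).integrableOn
  · exact Eventually.of_forall fun t y _ => hasDerivAt_airyMomentKernel k y t

lemma exists_norm_airyMoment_le (k : ℕ) :
    ∃ C : ℝ, ∀ x : ℝ, ‖airyMoment k x‖ ≤ C * Real.exp (-x) := by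
  refine ⟨∫ t in Ioi (0 : ℝ), k.factorial * Real.exp (-(1 / 2) * t ^ 2 + 3), fun x => ?_⟩
  rw [← integral_mul_const]
  refine norm_integral_le_of_norm_le
    (((integrable_gaussian_const one_half_pos _).const_mul _).mul_const _).integrableOn
    (Eventually.of_forall fun t => (norm_airyMomentKernel_le k x t).trans_eq ?_)
  rw [mul_assoc, ← Real.exp_add]
  ring_nf

lemma tendsto_airyKernel_atTop (x : ℝ) :
    Tendsto (fun t : ℝ => airyKernel x ((t : ℂ) + (1 : ℝ) * Complex.I)) atTop (𝓝 0) := by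
  rw [tendsto_zero_iff_norm_tendsto_zero]
  simp only [norm_airyKernel]
  refine Real.tendsto_exp_atBot.comp ?_
  have h1 : Tendsto (fun R : ℝ => -1 * R ^ 2) atTop atBot := by
    simp only [neg_mul, one_mul]
    exact tendsto_neg_atTop_atBot.comp (tendsto_pow_atTop two_ne_zero)
  simpa only [add_sub_assoc] using tendsto_atBot_add_const_right _ ((1 : ℝ) ^ 3 / 3 - x * 1) h1

/-- The difference of the integrands is the `t`-derivative of `i` times the kernel. The boundary
value at `t = 0` is purely imaginary, so the identity holds for real parts only. -/
lemma airyMoment_two_re (x : ℝ) : (airyMoment 2 x).re = x * (airyMoment 0 x).re := by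
  have hd : ∀ t : ℝ, HasDerivAt
      (fun t : ℝ => Complex.I * airyKernel x ((t : ℂ) + (1 : ℝ) * Complex.I))
      (airyMomentKernel 2 x t - x * airyMomentKernel 0 x t) t := by
    intro t
    have h1 : HasDerivAt (fun t : ℝ => (t : ℂ) + (1 : ℝ) * Complex.I) 1 t :=
      (Complex.ofRealCLM.hasDerivAt (x := t)).add_const _
    have h2 := ((hasDerivAt_airyKernel x _).comp t h1).const_mul Complex.I
    refine h2.congr_deriv ?_
    simp only [airyMomentKernel, mul_one, pow_zero, one_mul]
    rw [mul_pow, ← mul_assoc Complex.I, ← mul_assoc Complex.I, ← sq, Complex.I_sq]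
    ring
  have hint := integral_Ioi_of_hasDerivAt_of_tendsto' (a := 0) (fun t _ => hd t)
    ((integrable_airyMomentKernel 2 x).sub
      ((integrable_airyMomentKernel 0 x).const_mul (x : ℂ))).integrableOn
    ((tendsto_airyKernel_atTop x).const_mul Complex.I)
  rw [integral_sub (integrable_airyMomentKernel 2 x).integrableOn
    ((integrable_airyMomentKernel 0 x).const_mul (x : ℂ)).integrableOn, integral_const_mul] at hint
  have hre := congrArg Complex.re hint
  have him := im_airyKernel_mul_I x 1
  simp only [Complex.ofReal_zero, zero_add, mul_zero, zero_sub, Complex.sub_re, Complex.neg_re,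
    Complex.I_mul_re, him, neg_zero, Complex.re_ofReal_mul] at hre
  exact sub_eq_zero.1 hre

/-- The derivative of the Airy function. -/
noncomputable def airyAiDeriv (x : ℝ) : ℝ := (1 / Real.pi) * (airyMoment 1 x).re

lemma airyAi_eq_airyMoment (x : ℝ) : airyAi x = (1 / Real.pi) * (airyMoment 0 x).re := by
  simp [airyAi_eq_contour x one_pos, airyMoment, airyMomentKernel]

lemma hasDerivAt_airyMoment_re (k : ℕ) (x : ℝ) :
    HasDerivAt (fun x => (1 / Real.pi) * (airyMoment k x).re)
      ((1 / Real.pi) * (airyMoment (k + 1) x).re) x :=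
  (Complex.reCLM.hasFDerivAt.comp_hasDerivAt x (hasDerivAt_airyMoment k x)).const_mul _

lemma hasDerivAt_airyAi (x : ℝ) : HasDerivAt airyAi (airyAiDeriv x) x := by
  rw [show airyAi = _ from funext airyAi_eq_airyMoment]
  exact hasDerivAt_airyMoment_re 0 x

lemma hasDerivAt_airyAiDeriv (x : ℝ) : HasDerivAt airyAiDeriv (x * airyAi x) x := by
  refine (hasDerivAt_airyMoment_re 1 x).congr_deriv ?_
  rw [airyMoment_two_re, airyAi_eq_airyMoment]
  ring

lemma exists_abs_airyMoment_re_le (k : ℕ) :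
    ∃ C : ℝ, ∀ x : ℝ, |(1 / Real.pi) * (airyMoment k x).re| ≤ C * Real.exp (-x) := by
  obtain ⟨C, hC⟩ := exists_norm_airyMoment_le k
  refine ⟨1 / Real.pi * C, fun x => ?_⟩
  rw [abs_mul, abs_of_pos (by positivity : 0 < 1 / Real.pi), mul_assoc]
  gcongr
  exact (Complex.abs_re_le_norm _).trans (hC x)

lemma exists_abs_airyAi_le : ∃ C : ℝ, ∀ x : ℝ, |airyAi x| ≤ C * Real.exp (-x) := by
  simpa only [airyAi_eq_airyMoment] using exists_abs_airyMoment_re_le 0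

lemma exists_abs_airyAiDeriv_le : ∃ C : ℝ, ∀ x : ℝ, |airyAiDeriv x| ≤ C * Real.exp (-x) :=
  exists_abs_airyMoment_re_le 1

/-! ### Positivity on the half-line `x ≥ 0` -/

lemma integral_pow_six_mul_gaussian {η : ℝ} (hη : 0 < η) :
    ∫ t in Ioi (0 : ℝ), t ^ 6 * Real.exp (-η * t ^ 2) =
      15 / 16 * η ^ (-(7 / 2) : ℝ) * Real.Gamma (1 / 2) := by
  have h := integral_rpow_mul_exp_neg_mul_rpow (p := 2) (q := 6) two_pos (by norm_num) hη
  have hG : Real.Gamma (7 / 2) = 15 / 8 * Real.Gamma (1 / 2) := by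
    rw [show (7 / 2 : ℝ) = 1 / 2 + 1 + 1 + 1 by norm_num, Real.Gamma_add_one (by norm_num),
      Real.Gamma_add_one (by norm_num), Real.Gamma_add_one (by norm_num)]
    ring
  norm_num [hG] at h
  norm_num
  exact_mod_cast h.trans (by ring)

lemma integral_gaussian_Ioi_eq_Gamma {η : ℝ} (hη : 0 < η) :
    ∫ t in Ioi (0 : ℝ), Real.exp (-η * t ^ 2) =
      1 / 2 * η ^ (-(1 / 2) : ℝ) * Real.Gamma (1 / 2) := by
  have h := integral_rpow_mul_exp_neg_mul_rpow (p := 2) (q := 0) two_pos (by norm_num) hη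
  norm_num at h
  norm_num
  exact_mod_cast h.trans (by ring)

lemma integrableOn_pow_six_mul_gaussian {η : ℝ} (hη : 0 < η) :
    IntegrableOn (fun t : ℝ => t ^ 6 * Real.exp (-η * t ^ 2)) (Ioi 0) := by
  exact_mod_cast integrableOn_rpow_mul_exp_neg_mul_sq hη (s := (6 : ℕ))
    (by norm_num)

/-- With `cos s ≥ 1 - s²/2` at `s = t³/3` the loss is `t⁶/18`. Its Gaussian integral is `(5/96)
η^(-7/2) Γ(1/2)`, below the main term `(1/2) η^(-1/2) Γ(1/2)` when `η ≥ 1`. -/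
lemma integral_gaussian_mul_cos_cube_pos {η : ℝ} (hη : 1 ≤ η) :
    0 < ∫ t in Ioi (0 : ℝ), Real.exp (-η * t ^ 2) * Real.cos (t ^ 3 / 3) := by
  have hη0 : 0 < η := one_pos.trans_le hη
  have hg : IntegrableOn (fun t : ℝ => Real.exp (-η * t ^ 2)) (Ioi 0) :=
    (integrable_exp_neg_mul_sq hη0).integrableOn
  have h6 := integrableOn_pow_six_mul_gaussian hη0
  have hlow : ∫ t in Ioi (0 : ℝ),
      (Real.exp (-η * t ^ 2) - 1 / 18 * (t ^ 6 * Real.exp (-η * t ^ 2))) ≤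
      ∫ t in Ioi (0 : ℝ), Real.exp (-η * t ^ 2) * Real.cos (t ^ 3 / 3) := by
    refine integral_mono (hg.sub (h6.const_mul _)) ?_ fun t => ?_
    · refine hg.mono' (by fun_prop) (Eventually.of_forall fun t => ?_)
      rw [norm_mul, Real.norm_of_nonneg (Real.exp_pos _).le]
      exact mul_le_of_le_one_right (Real.exp_pos _).le (Real.abs_cos_le_one _)
    · have h := mul_le_mul_of_nonneg_left (Real.one_sub_sq_div_two_le_cos (x := t ^ 3 / 3))
        (Real.exp_pos (-η * t ^ 2)).le
      refine le_trans (le_of_eq ?_) h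
      ring
  refine lt_of_lt_of_le ?_ hlow
  rw [integral_sub hg (h6.const_mul _), integral_const_mul, integral_pow_six_mul_gaussian hη0,
    integral_gaussian_Ioi_eq_Gamma hη0]
  have hG : 0 < Real.Gamma (1 / 2) := Real.Gamma_pos_of_pos (by norm_num)
  have hp : η ^ (-(7 / 2) : ℝ) ≤ η ^ (-(1 / 2) : ℝ) :=
    Real.rpow_le_rpow_of_exponent_le hη (by norm_num)
  have hq : 0 < η ^ (-(7 / 2) : ℝ) := Real.rpow_pos_of_pos hη0 _
  nlinarith [mul_le_mul_of_nonneg_right hp hG.le, mul_pos hq hG]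

/-- At `η = √x` the terms of the phase linear in `t` cancel, leaving `t³/3`. -/
lemma airyAi_pos_of_one_le {x : ℝ} (hx : 1 ≤ x) : 0 < airyAi x := by
  have hη : 1 ≤ √x := Real.one_le_sqrt.2 hx
  rw [airyAi_eq_gaussian x (one_pos.trans_le hη)]
  have h : ∀ t : ℝ, Real.exp (-√x * t ^ 2 + √x ^ 3 / 3 - x * √x) *
      Real.cos (t ^ 3 / 3 - √x ^ 2 * t + x * t) =
      Real.exp (√x ^ 3 / 3 - x * √x) * (Real.exp (-√x * t ^ 2) * Real.cos (t ^ 3 / 3)) := by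
    intro t
    rw [add_sub_assoc, Real.exp_add, Real.sq_sqrt (by linarith), sub_add_cancel]
    ring
  simp only [h]
  rw [integral_const_mul]
  have := integral_gaussian_mul_cos_cube_pos hη
  positivity

lemma tendsto_pow_mul_of_abs_le_exp_neg {f : ℝ → ℝ} {C : ℝ}
    (hf : ∀ x, |f x| ≤ C * Real.exp (-x)) (k : ℕ) :
    Tendsto (fun x => x ^ k * f x) atTop (𝓝 0) := by
  have h := (Real.tendsto_pow_mul_exp_neg_atTop_nhds_zero k).const_mul C
  rw [mul_zero] at h
  refine squeeze_zero_norm' ?_ h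
  filter_upwards [eventually_ge_atTop 0] with x hx
  rw [norm_mul, Real.norm_of_nonneg (by positivity), Real.norm_eq_abs]
  calc x ^ k * |f x| ≤ x ^ k * (C * Real.exp (-x)) := by gcongr; exact hf x
    _ = _ := by ring

lemma tendsto_airyAi_atTop : Tendsto airyAi atTop (𝓝 0) := by
  obtain ⟨C, hC⟩ := exists_abs_airyAi_le
  simpa using tendsto_pow_mul_of_abs_le_exp_neg hC 0

lemma tendsto_id_mul_airyAi_atTop : Tendsto (fun x => x * airyAi x) atTop (𝓝 0) := by
  obtain ⟨C, hC⟩ := exists_abs_airyAi_le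
  simpa using tendsto_pow_mul_of_abs_le_exp_neg hC 1

lemma tendsto_airyAiDeriv_atTop : Tendsto airyAiDeriv atTop (𝓝 0) := by
  obtain ⟨C, hC⟩ := exists_abs_airyAiDeriv_le
  simpa using tendsto_pow_mul_of_abs_le_exp_neg hC 0

lemma continuous_airyAi : Continuous airyAi :=
  continuous_iff_continuousAt.2 fun x => (hasDerivAt_airyAi x).continuousAt

lemma continuous_airyAiDeriv : Continuous airyAiDeriv :=
  continuous_iff_continuousAt.2 fun x => (hasDerivAt_airyAiDeriv x).continuousAt

/-- `(Ai Ai')' = Ai'² + x Ai² ≥ 0` for `x ≥ 0`, and the product tends to `0` at infinity. -/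
lemma airyAi_mul_airyAiDeriv_nonpos {x : ℝ} (hx : 0 ≤ x) : airyAi x * airyAiDeriv x ≤ 0 := by
  have hmono : MonotoneOn (fun x => airyAi x * airyAiDeriv x) (Ici 0) := by
    refine monotoneOn_of_hasDerivWithinAt_nonneg (convex_Ici 0)
      (continuous_airyAi.mul continuous_airyAiDeriv).continuousOn
      (fun y _ => ((hasDerivAt_airyAi y).mul (hasDerivAt_airyAiDeriv y)).hasDerivWithinAt)
      fun y hy => ?_
    rw [interior_Ici] at hy
    have : 0 < y := hy
    nlinarith [mul_nonneg this.le (sq_nonneg (airyAi y)), sq_nonneg (airyAiDeriv y)]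
  have hlim : Tendsto (fun x => airyAi x * airyAiDeriv x) atTop (𝓝 0) := by
    simpa using tendsto_airyAi_atTop.mul tendsto_airyAiDeriv_atTop
  refine ge_of_tendsto hlim ?_
  filter_upwards [eventually_ge_atTop x] with y hy
  exact hmono hx (hx.trans hy) hy

lemma antitoneOn_airyAi_sq : AntitoneOn (fun x => airyAi x ^ 2) (Ici 0) := by
  refine antitoneOn_of_hasDerivWithinAt_nonpos (convex_Ici 0)
    (continuous_airyAi.pow 2).continuousOn
    (fun z _ => ((hasDerivAt_airyAi z).pow 2).hasDerivWithinAt) fun z hz => ?_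
  rw [interior_Ici] at hz
  have := airyAi_mul_airyAiDeriv_nonpos (le_of_lt hz)
  norm_num
  linarith

lemma airyAi_ne_zero_of_nonneg {x : ℝ} (hx : 0 ≤ x) : airyAi x ≠ 0 := by
  intro h0
  rcases le_total 1 x with h1 | h1
  · exact (airyAi_pos_of_one_le h1).ne' h0
  -- A zero in `[0, 1]` would force `Ai(1) = 0`, since `Ai²` decreases.
  · have h := antitoneOn_airyAi_sq hx (zero_le_one' ℝ) h1
    simp only [h0] at h
    nlinarith [airyAi_pos_of_one_le le_rfl]

lemma airyAi_pos_of_nonneg {x : ℝ} (hx : 0 ≤ x) : 0 < airyAi x := by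
  by_contra! hneg
  have hx1 : x < 1 := by
    by_contra! h1
    exact (airyAi_pos_of_one_le h1).not_ge hneg
  obtain ⟨c, hc, hc0⟩ := intermediate_value_Icc hx1.le continuous_airyAi.continuousOn
    ⟨hneg, (airyAi_pos_of_one_le le_rfl).le⟩
  exact airyAi_ne_zero_of_nonneg (hx.trans hc.1) hc0

lemma airyAiDeriv_neg_of_nonneg {x : ℝ} (hx : 0 ≤ x) : airyAiDeriv x < 0 := by
  have hmono : StrictMonoOn airyAiDeriv (Ici 0) := by
    refine strictMonoOn_of_hasDerivWithinAt_pos (convex_Ici 0) continuous_airyAiDeriv.continuousOn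
      (fun y _ => (hasDerivAt_airyAiDeriv y).hasDerivWithinAt) fun y hy => ?_
    rw [interior_Ici] at hy
    exact mul_pos hy (airyAi_pos_of_nonneg (le_of_lt hy))
  have h1 : airyAiDeriv x < airyAiDeriv (x + 1) :=
    hmono hx (by simp only [mem_Ici]; linarith) (by linarith)
  refine h1.trans_le (ge_of_tendsto tendsto_airyAiDeriv_atTop ?_)
  filter_upwards [eventually_ge_atTop (x + 1)] with y hy
  exact hmono.monotoneOn (by simp only [mem_Ici]; linarith) (by simp only [mem_Ici]; linarith) hy

/-! ### Energy and the `L²` norm -/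

/-- The decreasing energy `Ai'² - x Ai²` of the Airy equation. -/
noncomputable def airyEnergy (x : ℝ) : ℝ := airyAiDeriv x ^ 2 - x * airyAi x ^ 2

lemma hasDerivAt_airyEnergy (x : ℝ) : HasDerivAt airyEnergy (-airyAi x ^ 2) x := by
  have h := ((hasDerivAt_airyAiDeriv x).pow 2).sub
    ((hasDerivAt_id x).mul ((hasDerivAt_airyAi x).pow 2))
  refine h.congr_deriv ?_
  simp
  ring

lemma antitone_airyEnergy : Antitone airyEnergy :=
  antitone_of_hasDerivAt_nonpos hasDerivAt_airyEnergy fun x => by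
    simpa using sq_nonneg (airyAi x)

lemma tendsto_airyEnergy_atTop : Tendsto airyEnergy atTop (𝓝 0) := by
  have h := (tendsto_airyAiDeriv_atTop.pow 2).sub
    (tendsto_id_mul_airyAi_atTop.mul tendsto_airyAi_atTop)
  norm_num at h
  refine h.congr fun x => ?_
  rw [airyEnergy]; ring

/-- The strict decrease needed comes from `Ai > 0` on `[0, ∞)`. Positivity makes every zero of `Ai`
simple. -/
lemma airyEnergy_pos (x : ℝ) : 0 < airyEnergy x := by
  have hanti : StrictAntiOn airyEnergy (Ici 0) := by
    refine strictAntiOn_of_hasDerivWithinAt_neg (convex_Ici 0)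
      (fun y _ => (hasDerivAt_airyEnergy y).continuousAt.continuousWithinAt)
      (fun y _ => (hasDerivAt_airyEnergy y).hasDerivWithinAt) fun y hy => ?_
    rw [interior_Ici] at hy
    have := pow_pos (airyAi_pos_of_nonneg (le_of_lt hy)) 2
    linarith
  have hm := le_max_right x 0
  calc 0 ≤ airyEnergy (max x 0 + 1) :=
        antitone_airyEnergy.le_of_tendsto tendsto_airyEnergy_atTop _
    _ < airyEnergy (max x 0) := hanti hm (by simp only [mem_Ici]; linarith) (by linarith)
    _ ≤ airyEnergy x := antitone_airyEnergy (le_max_left _ _)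

lemma integrableOn_airyAi_sub_sq (a : ℝ) :
    IntegrableOn (fun x => airyAi (x - a) ^ 2) (Ioi 0) := by
  have h := integrableOn_Ioi_deriv_of_nonpos' (a := 0)
    (fun x _ => (hasDerivAt_airyEnergy (x - a)).comp_sub_const x a)
    (fun _ _ => neg_nonpos.2 (sq_nonneg _))
    (tendsto_airyEnergy_atTop.comp (tendsto_atTop_add_const_right _ (-a) tendsto_id))
  simpa using h.neg

lemma integral_airyAi_sub_sq (a : ℝ) :
    ∫ x in Ioi 0, airyAi (x - a) ^ 2 = airyEnergy (-a) := by
  have h := integral_Ioi_of_hasDerivAt_of_tendsto' (a := 0)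
    (fun x _ => (hasDerivAt_airyEnergy (x - a)).comp_sub_const x a)
    (integrableOn_airyAi_sub_sq a).neg
    (tendsto_airyEnergy_atTop.comp (tendsto_atTop_add_const_right _ (-a) tendsto_id))
  rw [integral_neg, zero_sub, zero_sub] at h
  linarith

/-! ### Sturm comparison for `u(x) = Ai(-x)` -/

lemma hasDerivAt_airyAi_neg (x : ℝ) :
    HasDerivAt (fun x => airyAi (-x)) (-airyAiDeriv (-x)) x := by
  exact ((hasDerivAt_airyAi (-x)).comp x (hasDerivAt_neg x)).congr_deriv (by ring)

lemma hasDerivAt_neg_airyAiDeriv_neg (x : ℝ) :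
    HasDerivAt (fun x => -airyAiDeriv (-x)) (-x * airyAi (-x)) x := by
  exact ((hasDerivAt_airyAiDeriv (-x)).comp x (hasDerivAt_neg x)).neg.congr_deriv (by ring)

lemma hasDerivAt_sturmWronskian {u v : ℝ → ℝ} (hu : ∀ x, HasDerivAt u (v x) x)
    (hv : ∀ x, HasDerivAt v (-x * u x) x) (a ω x : ℝ) :
    HasDerivAt (fun x => v x * Real.sin (ω * (x - a)) - ω * (u x * Real.cos (ω * (x - a))))
      ((ω ^ 2 - x) * (u x * Real.sin (ω * (x - a)))) x := by
  have hl : HasDerivAt (fun x => ω * (x - a)) ω x := by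
    simpa using ((hasDerivAt_id x).sub_const a).const_mul ω
  have h := ((hv x).mul hl.sin).sub (((hu x).mul hl.cos).const_mul ω)
  refine h.congr_deriv ?_
  ring

/-- Sturm comparison: a solution of `u'' = -x u` is not positive on an interval to the right of
`a > 0` of length at least `π / √a`. -/
lemma sturm_not_pos {u v : ℝ → ℝ} (hu : ∀ x, HasDerivAt u (v x) x)
    (hv : ∀ x, HasDerivAt v (-x * u x) x) {a : ℝ} (ha : 0 < a)
    (hpos : ∀ x ∈ Ioo a (a + Real.pi / √a), 0 < u x) : False := by
  have hω : 0 < √a := Real.sqrt_pos.2 ha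
  have hab : a < a + Real.pi / √a := by have := Real.pi_pos; linarith [div_pos this hω]
  have huc : Continuous u := continuous_iff_continuousAt.2 fun x => (hu x).continuousAt
  have hcl : ∀ x ∈ Icc a (a + Real.pi / √a), 0 ≤ u x := by
    rw [← closure_Ioo hab.ne]
    exact fun x hx => closure_minimal (fun y hy => (hpos y hy).le)
      (isClosed_le continuous_const huc) hx
  have hanti := strictAntiOn_of_hasDerivWithinAt_neg (convex_Icc a (a + Real.pi / √a))
    (fun x _ => (hasDerivAt_sturmWronskian hu hv a √a x).continuousAt.continuousWithinAt)
    (fun x _ => (hasDerivAt_sturmWronskian hu hv a √a x).hasDerivWithinAt) fun x hx => by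
      rw [interior_Icc] at hx
      have hs : 0 < Real.sin (√a * (x - a)) := by
        refine Real.sin_pos_of_pos_of_lt_pi (mul_pos hω (sub_pos.2 hx.1)) ?_
        have := hx.2
        rw [← sub_lt_iff_lt_add', lt_div_iff₀' hω] at this
        exact this
      rw [Real.sq_sqrt ha.le]
      exact mul_neg_of_neg_of_pos (by linarith [hx.1]) (mul_pos (hpos x hx) hs)
  -- The Wronskian is `-√a u(a) ≤ 0` at the left end and `√a u(b) ≥ 0` at the right end `b = a + π /
  -- √a`, so it cannot strictly decrease.
  have h := hanti (left_mem_Icc.2 hab.le) (right_mem_Icc.2 hab.le) hab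
  have hpi : √a * (a + Real.pi / √a - a) = Real.pi := by field_simp; ring
  simp only [hpi, sub_self, mul_zero, Real.sin_zero, Real.cos_zero, Real.sin_pi, Real.cos_pi] at h
  nlinarith [mul_nonneg hω.le (hcl _ (left_mem_Icc.2 hab.le)),
    mul_nonneg hω.le (hcl _ (right_mem_Icc.2 hab.le))]

lemma deriv_nonpos_of_pos_left {u : ℝ → ℝ} {u' a b : ℝ} (hu : HasDerivAt u u' b) (hab : a < b)
    (hpos : ∀ x ∈ Ioo a b, 0 < u x) (hub : u b = 0) : u' ≤ 0 := by
  refine le_of_tendsto (hasDerivAt_iff_tendsto_slope.1 hu |>.mono_left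
    (nhdsWithin_mono b (show Iio b ⊆ {b}ᶜ from fun x hx => ne_of_lt hx))) ?_
  filter_upwards [Ioo_mem_nhdsLT hab] with x hx
  rw [slope_def_field, hub]
  exact div_nonpos_of_nonneg_of_nonpos (by linarith [hpos x hx]) (by linarith [hx.2])

lemma deriv_nonneg_of_pos_right {u : ℝ → ℝ} {u' a b : ℝ} (hu : HasDerivAt u u' a) (hab : a < b)
    (hpos : ∀ x ∈ Ioo a b, 0 < u x) (hua : u a = 0) : 0 ≤ u' := by
  refine ge_of_tendsto (hasDerivAt_iff_tendsto_slope.1 hu |>.mono_left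
    (nhdsWithin_mono a (show Ioi a ⊆ {a}ᶜ from fun x hx => ne_of_gt hx))) ?_
  filter_upwards [Ioo_mem_nhdsGT hab] with x hx
  rw [slope_def_field, hua]
  exact div_nonneg (by linarith [hpos x hx]) (by linarith [hx.1])

/-- Sturm comparison: the length of an interval between zeros of a solution of `u'' = -x u` that
is positive inside. -/
lemma sturm_gap {u v : ℝ → ℝ} (hu : ∀ x, HasDerivAt u (v x) x)
    (hv : ∀ x, HasDerivAt v (-x * u x) x) {a b : ℝ} (hb : 0 < b) (hab : a < b)
    (hpos : ∀ x ∈ Ioo a b, 0 < u x) (hua : u a = 0) (hub : u b = 0) :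
    Real.pi / √b ≤ b - a := by
  have hω : 0 < √b := Real.sqrt_pos.2 hb
  by_contra! hlt
  rw [lt_div_iff₀' hω] at hlt
  have hs : ∀ x ∈ Ioc a b, 0 < Real.sin (√b * (x - a)) := fun x hx => by
    refine Real.sin_pos_of_pos_of_lt_pi (mul_pos hω (sub_pos.2 hx.1)) (lt_of_le_of_lt ?_ hlt)
    have := hx.2
    gcongr
  have hmono := strictMonoOn_of_hasDerivWithinAt_pos (convex_Icc a b)
    (fun x _ => (hasDerivAt_sturmWronskian hu hv a √b x).continuousAt.continuousWithinAt)
    (fun x _ => (hasDerivAt_sturmWronskian hu hv a √b x).hasDerivWithinAt) fun x hx => by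
      rw [interior_Icc] at hx
      rw [Real.sq_sqrt hb.le]
      exact mul_pos (sub_pos.2 hx.2) (mul_pos (hpos x hx) (hs x ⟨hx.1, hx.2.le⟩))
  -- The Wronskian vanishes at `a`, so at `b` it is positive; there it equals `v b` times a positive
  -- sine, while `v b ≤ 0`.
  have h := hmono (left_mem_Icc.2 hab.le) (right_mem_Icc.2 hab.le) hab
  simp only [hua, hub, sub_self, mul_zero, Real.sin_zero, zero_mul, sub_zero] at h
  have hvb : v b ≤ 0 := deriv_nonpos_of_pos_left (hu b) hab hpos hub
  nlinarith [hs b ⟨hab, le_rfl⟩]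

lemma airyAi_neg_sign_of_ne_zero {a b : ℝ} (h : ∀ x ∈ Ioo a b, airyAi (-x) ≠ 0) :
    (∀ x ∈ Ioo a b, 0 < airyAi (-x)) ∨ ∀ x ∈ Ioo a b, 0 < -airyAi (-x) := by
  have hc : ContinuousOn (fun x => airyAi (-x)) (Ioo a b) :=
    (continuous_airyAi.comp continuous_neg).continuousOn
  by_contra! hcon
  obtain ⟨⟨x, hx, hx0⟩, ⟨y, hy, hy0⟩⟩ := hcon
  obtain ⟨c, hc, hc0⟩ := isPreconnected_Ioo.intermediate_value hx hy hc
    ⟨hx0, by linarith⟩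
  exact h c hc hc0

lemma exists_airyAi_neg_eq_zero {a : ℝ} (ha : 0 < a) :
    ∃ x ∈ Ioo a (a + Real.pi / √a), airyAi (-x) = 0 := by
  by_contra! h
  rcases airyAi_neg_sign_of_ne_zero h with h | h
  · exact sturm_not_pos hasDerivAt_airyAi_neg hasDerivAt_neg_airyAiDeriv_neg ha h
  · refine sturm_not_pos (fun x => (hasDerivAt_airyAi_neg x).neg)
      (fun x => (hasDerivAt_neg_airyAiDeriv_neg x).neg.congr_deriv ?_) ha h
    simp

lemma airyAi_zero_gap {a b : ℝ} (hb : 0 < b) (hab : a < b)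
    (h : ∀ x ∈ Ioo a b, airyAi (-x) ≠ 0) (hua : airyAi (-a) = 0) (hub : airyAi (-b) = 0) :
    Real.pi / √b ≤ b - a := by
  rcases airyAi_neg_sign_of_ne_zero h with h | h
  · exact sturm_gap hasDerivAt_airyAi_neg hasDerivAt_neg_airyAiDeriv_neg hb hab h hua hub
  · refine sturm_gap (fun x => (hasDerivAt_airyAi_neg x).neg)
      (fun x => (hasDerivAt_neg_airyAiDeriv_neg x).neg.congr_deriv ?_) hb hab h ?_ ?_
    all_goals simp [hua, hub]

lemma airyAiDeriv_ne_zero_of_zero {x : ℝ} (hx : airyAi x = 0) : airyAiDeriv x ≠ 0 := by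
  intro h
  have := airyEnergy_pos x
  simp [airyEnergy, hx, h] at this

lemma eventually_airyAi_neg_ne_zero (a : ℝ) : ∀ᶠ x in 𝓝[>] a, airyAi (-x) ≠ 0 := by
  have hle : 𝓝[>] a ≤ 𝓝[≠] a := nhdsWithin_mono a fun x hx => ne_of_gt hx
  by_cases h : airyAi (-a) = 0
  · exact hle ((hasDerivAt_airyAi_neg a).eventually_ne
      (neg_ne_zero.2 (airyAiDeriv_ne_zero_of_zero h)))
  · exact (hle.trans nhdsWithin_le_nhds)
      ((continuous_airyAi.comp continuous_neg).continuousAt.eventually_ne h)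

/-! ### Enumeration of the zeros -/

lemma isLeast_sInf_airyAi_zero (a : ℝ) :
    IsLeast {b : ℝ | a < b ∧ airyAi (-b) = 0} (sInf {b : ℝ | a < b ∧ airyAi (-b) = 0}) := by
  set S := {b : ℝ | a < b ∧ airyAi (-b) = 0} with hS
  have hbdd : BddBelow S := ⟨a, fun b hb => hb.1.le⟩
  have hne : S.Nonempty := by
    obtain ⟨x, hx, hx0⟩ := exists_airyAi_neg_eq_zero (lt_max_of_lt_right one_pos : 0 < max a 1)
    exact ⟨x, (le_max_left _ _).trans_lt hx.1, hx0⟩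
  obtain ⟨c, hac, hc⟩ := (mem_nhdsGT_iff_exists_Ioo_subset).1 (eventually_airyAi_neg_ne_zero a)
  -- No zero lies in `(a, c)`, so `a < b` may be replaced by the closed condition `c ≤ b`; thus the
  -- infimum is attained.
  have hSc : S = Ici c ∩ (fun b => airyAi (-b)) ⁻¹' {0} := by
    ext b
    constructor
    · rintro ⟨hb, hb0⟩
      refine ⟨?_, hb0⟩
      by_contra! hbc
      exact hc ⟨hb, not_le.1 hbc⟩ hb0
    · rintro ⟨hb, hb0⟩
      exact ⟨lt_of_lt_of_le hac hb, hb0⟩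
  have hcl : IsClosed S := by
    rw [hSc]
    exact isClosed_Ici.inter (isClosed_singleton.preimage (continuous_airyAi.comp continuous_neg))
  exact ⟨hcl.csInf_mem hne hbdd, fun b hb => csInf_le hbdd hb⟩

lemma pos_of_airyAi_neg_eq_zero {a : ℝ} (h : airyAi (-a) = 0) : 0 < a := by
  by_contra! ha
  exact airyAi_ne_zero_of_nonneg (neg_nonneg.2 ha) h

/-- The value `0` at index `0` is a harmless lower bound, because `Ai(-b) = 0` forces `b > 0`. This
makes the recursion uniform in `n`. -/
lemma isLeast_airyAlpha_succ (n : ℕ) :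
    IsLeast {b : ℝ | airyAlpha n < b ∧ airyAi (-b) = 0} (airyAlpha (n + 1)) := by
  have h := isLeast_sInf_airyAi_zero (airyAlpha n)
  cases n with
  | zero =>
    have hset : {b : ℝ | airyAlpha 0 < b ∧ airyAi (-b) = 0} = {b : ℝ | airyAi (-b) = 0} := by
      ext b
      refine ⟨fun hb => hb.2, fun hb => ⟨?_, hb⟩⟩
      rw [airyAlpha]
      exact pos_of_airyAi_neg_eq_zero hb
    rw [hset] at h ⊢
    exact h
  | succ n => exact h

lemma strictMono_airyAlpha : StrictMono airyAlpha :=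
  strictMono_nat_of_lt_succ fun n => (isLeast_airyAlpha_succ n).1.1

lemma airyAlpha_zero : airyAlpha 0 = 0 := by rw [airyAlpha]

lemma airyAlpha_pos {n : ℕ} (hn : 1 ≤ n) : 0 < airyAlpha n :=
  airyAlpha_zero ▸ strictMono_airyAlpha (Nat.lt_of_lt_of_le one_pos hn)

lemma airyAlpha_nonneg (n : ℕ) : 0 ≤ airyAlpha n :=
  airyAlpha_zero ▸ strictMono_airyAlpha.monotone n.zero_le

lemma airyAi_neg_airyAlpha {n : ℕ} (hn : 1 ≤ n) : airyAi (-airyAlpha n) = 0 := by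
  obtain ⟨m, rfl⟩ := Nat.exists_eq_add_of_le' hn
  exact (isLeast_airyAlpha_succ m).1.2

lemma airyAi_neg_ne_zero_of_mem_Ioo {n : ℕ} :
    ∀ x ∈ Ioo (airyAlpha n) (airyAlpha (n + 1)), airyAi (-x) ≠ 0 := fun _ hx h0 =>
  ((isLeast_airyAlpha_succ n).2 ⟨hx.1, h0⟩).not_gt hx.2

lemma airyAlpha_succ_sub_le {n : ℕ} (hn : 1 ≤ n) :
    airyAlpha (n + 1) - airyAlpha n ≤ Real.pi / √(airyAlpha n) := by
  obtain ⟨x, hx, hx0⟩ := exists_airyAi_neg_eq_zero (airyAlpha_pos hn)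
  have := (isLeast_airyAlpha_succ n).2 ⟨hx.1, hx0⟩
  linarith [hx.2]

lemma le_airyAlpha_succ_sub {n : ℕ} (hn : 1 ≤ n) :
    Real.pi / √(airyAlpha (n + 1)) ≤ airyAlpha (n + 1) - airyAlpha n :=
  airyAi_zero_gap (airyAlpha_pos (by omega)) (strictMono_airyAlpha n.lt_succ_self)
    airyAi_neg_ne_zero_of_mem_Ioo (airyAi_neg_airyAlpha hn) (airyAi_neg_airyAlpha (by omega))

/-- A finite limit `l` would make the gaps tend to `0`, yet they are at least `π / √l`. -/
lemma tendsto_airyAlpha_atTop : Tendsto airyAlpha atTop atTop := by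
  rcases tendsto_atTop_of_monotone strictMono_airyAlpha.monotone with h | ⟨l, hl⟩
  · exact h
  · exfalso
    have hle : ∀ n, airyAlpha n ≤ l := strictMono_airyAlpha.monotone.ge_of_tendsto hl
    have hl0 : 0 < l := (airyAlpha_pos le_rfl).trans_le (hle 1)
    have hd := ((tendsto_add_atTop_iff_nat 1).2 hl).sub hl
    rw [sub_self] at hd
    have : Real.pi / √l ≤ 0 := by
      refine ge_of_tendsto hd ?_
      filter_upwards [eventually_ge_atTop 1] with n hn
      refine le_trans ?_ (le_airyAlpha_succ_sub hn)
      have h1 := Real.sqrt_pos.2 (airyAlpha_pos (n := n + 1) (by omega))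
      have h2 := hle (n + 1)
      have := Real.pi_pos
      gcongr
    exact this.not_gt (div_pos Real.pi_pos (Real.sqrt_pos.2 hl0))

lemma airyAi_zeros_eq_image :
    {x : ℝ | airyAi x = 0} = (fun n : ℕ => -airyAlpha n) '' Ici 1 := by
  ext x
  constructor
  · intro hx
    have hx' : airyAi (-(-x)) = 0 := by rwa [neg_neg]
    have hpos := pos_of_airyAi_neg_eq_zero hx'
    have hex : ∃ n, -x ≤ airyAlpha n := (tendsto_airyAlpha_atTop.eventually_ge_atTop (-x)).exists
    classical
    have hN := Nat.find_spec hex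
    have hmin := fun m => Nat.find_min hex (m := m)
    generalize Nat.find hex = N at hN hmin
    cases N with
    | zero => rw [airyAlpha_zero] at hN; linarith
    | succ m =>
      have hm := not_le.1 (hmin m m.lt_succ_self)
      have := (isLeast_airyAlpha_succ m).2 ⟨hm, hx'⟩
      exact ⟨m + 1, by simp, by simp only; linarith⟩
  · rintro ⟨n, hn, rfl⟩
    exact airyAi_neg_airyAlpha hn

/-! ### Alternation of signs -/

lemma neg_one_pow_mul_airyAi_neg_sign (n : ℕ) :
    (∀ x ∈ Ioo (airyAlpha n) (airyAlpha (n + 1)), 0 < (-1) ^ n * airyAi (-x)) ∨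
      ∀ x ∈ Ioo (airyAlpha n) (airyAlpha (n + 1)), 0 < (-1) ^ (n + 1) * airyAi (-x) := by
  have h := airyAi_neg_sign_of_ne_zero (airyAi_neg_ne_zero_of_mem_Ioo (n := n))
  rcases neg_one_pow_eq_or ℝ n with hn | hn
  · simpa [pow_succ, hn] using h
  · simpa [pow_succ, hn] using h.symm

lemma hasDerivAt_neg_one_pow_mul_airyAi_neg (n : ℕ) (x : ℝ) :
    HasDerivAt (fun x => (-1) ^ n * airyAi (-x)) ((-1) ^ (n + 1) * airyAiDeriv (-x)) x :=
  ((hasDerivAt_airyAi_neg x).const_mul _).congr_deriv (by ring)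

/-- The same sign on both sides of a zero would force the derivative there to vanish, against
simplicity. The induction starts from `Ai(0) > 0`. -/
lemma airyAi_neg_alternating (n : ℕ) :
    ∀ x ∈ Ioo (airyAlpha n) (airyAlpha (n + 1)), 0 < (-1) ^ n * airyAi (-x) := by
  induction n with
  | zero =>
    refine (neg_one_pow_mul_airyAi_neg_sign 0).resolve_right fun h => ?_
    have hlt := strictMono_airyAlpha zero_lt_one
    have h0 : ∀ᶠ x in 𝓝[>] airyAlpha 0, 0 < airyAi (-x) := by
      refine nhdsWithin_le_nhds ((continuous_airyAi.comp continuous_neg).continuousAt.eventually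
        (lt_mem_nhds ?_))
      rw [airyAlpha_zero]
      exact airyAi_pos_of_nonneg (by simp)
    obtain ⟨x, hx, hx0⟩ := ((show ∀ᶠ x in 𝓝[>] airyAlpha 0, x ∈ Ioo (airyAlpha 0) (airyAlpha 1) from
      Ioo_mem_nhdsGT hlt).and h0).exists
    have := h x hx
    simp at this
    linarith
  | succ n ih =>
    refine (neg_one_pow_mul_airyAi_neg_sign (n + 1)).resolve_right fun h => ?_
    have hz := airyAi_neg_airyAlpha (n := n + 1) (by omega)
    have h1 := deriv_nonpos_of_pos_left (hasDerivAt_neg_one_pow_mul_airyAi_neg n _)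
      (strictMono_airyAlpha n.lt_succ_self) ih (by simp [hz])
    have h2 := deriv_nonneg_of_pos_right (hasDerivAt_neg_one_pow_mul_airyAi_neg (n + 2) _)
      (strictMono_airyAlpha (n + 1).lt_succ_self) h (by simp [hz])
    have h3 : ((-1) ^ (n + 1) * airyAiDeriv (-airyAlpha (n + 1)) : ℝ) ≠ 0 :=
      mul_ne_zero (by simp) (airyAiDeriv_ne_zero_of_zero hz)
    refine h3 (le_antisymm h1 (h2.trans_eq ?_))
    rw [pow_add _ (n + 1) 2] at *
    ring

lemma neg_one_pow_mul_airyAiDeriv_pos {n : ℕ} (hn : 1 ≤ n) :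
    0 < (-1) ^ (n + 1) * airyAiDeriv (-airyAlpha n) := by
  obtain ⟨m, rfl⟩ := Nat.exists_eq_add_of_le' hn
  have hz := airyAi_neg_airyAlpha (n := m + 1) (by omega)
  have h1 := deriv_nonpos_of_pos_left (hasDerivAt_neg_one_pow_mul_airyAi_neg m _)
    (strictMono_airyAlpha m.lt_succ_self) (airyAi_neg_alternating m) (by simp [hz])
  have h3 : ((-1) ^ (m + 1) * airyAiDeriv (-airyAlpha (m + 1)) : ℝ) ≠ 0 :=
    mul_ne_zero (by simp) (airyAiDeriv_ne_zero_of_zero hz)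
  have h4 := lt_of_le_of_ne h1 h3
  rw [pow_succ]
  linarith

lemma neg_one_pow_mul_abs_airyAiDeriv {n : ℕ} (hn : 1 ≤ n) :
    (-1) ^ (n + 1) * |airyAiDeriv (-airyAlpha n)| = airyAiDeriv (-airyAlpha n) := by
  have h := neg_one_pow_mul_airyAiDeriv_pos hn
  rcases neg_one_pow_eq_or ℝ (n + 1) with h1 | h1 <;> rw [h1] at h ⊢
  · rw [abs_of_pos (by linarith)]; ring
  · rw [abs_of_neg (by linarith)]; ring

/-! ### Asymptotics of the zeros -/

/-- The difference of the sides is `(t - s)² (t + s/2)`. Exchanging `s` and `t` gives the matching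
upper bound for `t³ - s³`. -/
lemma three_halves_mul_sq_sub_sq_le {s t : ℝ} (hs : 0 ≤ s) (ht : 0 ≤ t) :
    3 / 2 * s * (t ^ 2 - s ^ 2) ≤ t ^ 3 - s ^ 3 := by
  nlinarith [mul_nonneg (sq_nonneg (t - s)) (by positivity : 0 ≤ t + s / 2)]

lemma tendsto_sqrt_airyAlpha_ratio :
    Tendsto (fun n => √(airyAlpha (n + 1)) / √(airyAlpha n)) atTop (𝓝 1) := by
  have hs : Tendsto (fun n => √(airyAlpha n)) atTop atTop :=
    Real.tendsto_sqrt_atTop.comp tendsto_airyAlpha_atTop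
  have h3 : Tendsto (fun n => 1 + Real.pi / √(airyAlpha n) ^ 3) atTop (𝓝 1) := by
    simpa using (tendsto_const_nhds.div_atTop
      ((tendsto_pow_atTop three_ne_zero).comp hs)).const_add (1 : ℝ)
  refine tendsto_of_tendsto_of_tendsto_of_le_of_le' tendsto_const_nhds h3 ?_ ?_
  · filter_upwards [eventually_ge_atTop 1] with n hn
    rw [one_le_div (Real.sqrt_pos.2 (airyAlpha_pos hn))]
    exact Real.sqrt_le_sqrt (strictMono_airyAlpha n.lt_succ_self).le
  · filter_upwards [eventually_ge_atTop 1] with n hn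
    have h1 := airyAlpha_succ_sub_le hn
    have hp := Real.sqrt_pos.2 (airyAlpha_pos hn)
    have hle := Real.sqrt_le_sqrt (strictMono_airyAlpha n.lt_succ_self).le
    have e1 := Real.sq_sqrt (airyAlpha_nonneg n)
    have e2 := Real.sq_sqrt (airyAlpha_nonneg (n + 1))
    generalize √(airyAlpha n) = s at *
    generalize √(airyAlpha (n + 1)) = t at *
    rw [← e1, ← e2, le_div_iff₀ hp] at h1
    have : (t - s) * s ^ 2 ≤ Real.pi := by
      refine le_trans ?_ h1
      nlinarith [mul_nonneg (mul_nonneg (sub_nonneg.2 hle) hp.le) (hp.le.trans hle)]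
    rw [div_le_iff₀ hp, add_mul, one_mul, ← sub_le_iff_le_add', div_mul_eq_mul_div,
      le_div_iff₀ (by positivity)]
    nlinarith

lemma tendsto_sqrt_airyAlpha_cube_sub :
    Tendsto (fun n => √(airyAlpha (n + 1)) ^ 3 - √(airyAlpha n) ^ 3) atTop
      (𝓝 (3 * Real.pi / 2)) := by
  have hr := tendsto_sqrt_airyAlpha_ratio
  have hl := (hr.inv₀ one_ne_zero).const_mul (3 * Real.pi / 2)
  have hu := hr.const_mul (3 * Real.pi / 2)
  rw [inv_one, mul_one] at hl
  rw [mul_one] at hu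
  refine tendsto_of_tendsto_of_tendsto_of_le_of_le' hl hu ?_ ?_
  all_goals
    filter_upwards [eventually_ge_atTop 1] with n hn
    have h1 := airyAlpha_succ_sub_le hn
    have h2 := le_airyAlpha_succ_sub hn
    have hp := Real.sqrt_pos.2 (airyAlpha_pos hn)
    have hq := Real.sqrt_pos.2 (airyAlpha_pos (n := n + 1) (by omega))
    have e1 := Real.sq_sqrt (airyAlpha_nonneg n)
    have e2 := Real.sq_sqrt (airyAlpha_nonneg (n + 1))
    generalize √(airyAlpha n) = s at *
    generalize √(airyAlpha (n + 1)) = t at *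
    rw [← e1, ← e2] at h1 h2
  · calc 3 * Real.pi / 2 * (t / s)⁻¹ = 3 / 2 * s * (Real.pi / t) := by field_simp
      _ ≤ 3 / 2 * s * (t ^ 2 - s ^ 2) := by gcongr
      _ ≤ _ := three_halves_mul_sq_sub_sq_le hp.le hq.le
  · calc t ^ 3 - s ^ 3 ≤ 3 / 2 * t * (t ^ 2 - s ^ 2) := by
          have := three_halves_mul_sq_sub_sq_le hq.le hp.le
          linarith
      _ ≤ 3 / 2 * t * (Real.pi / s) := by gcongr
      _ = _ := by field_simp

lemma tendsto_airyAlpha_mul_rpow :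
    Tendsto (fun n : ℕ => airyAlpha n * (n : ℝ) ^ (-(2 / 3) : ℝ)) atTop
      (𝓝 ((3 * Real.pi / 2) ^ (2 / 3 : ℝ))) := by
  have hc := tendsto_sqrt_airyAlpha_cube_sub.cesaro
  have hp := Real.pi_pos
  have h := hc.rpow_const (p := 2 / 3) (Or.inl (by positivity))
  refine h.congr fun n => ?_
  -- The sum telescopes to `αₙ^(3/2)` exactly because `airyAlpha 0 = 0`.
  rw [Finset.sum_range_sub (fun n => √(airyAlpha n) ^ 3), airyAlpha_zero, Real.sqrt_zero,
    zero_pow three_ne_zero, sub_zero, Real.mul_rpow (by positivity) (by positivity),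
    Real.inv_rpow (by positivity), Real.rpow_neg (by positivity), mul_comm]
  congr 1
  rw [← Real.rpow_natCast, ← Real.rpow_mul (Real.sqrt_nonneg _)]
  norm_num
  exact Real.sq_sqrt (airyAlpha_nonneg n)

/-! ### Normalization and the derivative at the origin -/

lemma memLp_airyAi_sub (a : ℝ) :
    MemLp (fun x : ℝ => airyAi (x - a)) 2 (volume.restrict (Ioi (0 : ℝ))) :=
  (memLp_two_iff_integrable_sq
    (continuous_airyAi.comp (continuous_id.sub continuous_const)).aestronglyMeasurable).2
    (integrableOn_airyAi_sub_sq a)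

lemma airyEnergy_neg_airyAlpha {n : ℕ} (hn : 1 ≤ n) :
    airyEnergy (-airyAlpha n) = airyAiDeriv (-airyAlpha n) ^ 2 := by
  simp [airyEnergy, airyAi_neg_airyAlpha hn]

lemma airyNorm_eq {n : ℕ} (hn : 1 ≤ n) :
    airyNorm n = ENNReal.ofReal |airyAiDeriv (-airyAlpha n)| := by
  rw [airyNorm, (memLp_airyAi_sub _).eLpNorm_eq_integral_rpow_norm (by simp) (by simp)]
  simp only [ENNReal.toReal_ofNat, Real.rpow_two, Real.norm_eq_abs, sq_abs]
  rw [integral_airyAi_sub_sq, airyEnergy_neg_airyAlpha hn, ← Real.sqrt_sq_eq_abs,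
    Real.sqrt_eq_rpow]
  norm_num

lemma airyPsi_eq {n : ℕ} (hn : 1 ≤ n) (x : ℝ) :
    airyPsi n x = airyAi (x - airyAlpha n) / |airyAiDeriv (-airyAlpha n)| := by
  rw [airyPsi, airyNorm_eq hn, ENNReal.toReal_ofReal (abs_nonneg _)]

lemma abs_airyAiDeriv_pos {n : ℕ} (hn : 1 ≤ n) : 0 < |airyAiDeriv (-airyAlpha n)| :=
  abs_pos.2 (airyAiDeriv_ne_zero_of_zero (airyAi_neg_airyAlpha hn))

lemma hasDerivAt_airyPsi_zero {n : ℕ} (hn : 1 ≤ n) :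
    HasDerivAt (airyPsi n) ((-1 : ℝ) ^ (n + 1)) 0 := by
  rw [show airyPsi n = _ from funext (airyPsi_eq hn)]
  refine (((hasDerivAt_airyAi (0 - airyAlpha n)).comp_sub_const 0 _).div_const _).congr_deriv ?_
  rw [zero_sub, div_eq_iff (abs_airyAiDeriv_pos hn).ne', neg_one_pow_mul_abs_airyAiDeriv hn]

/-! ### The pointwise bound -/

/-- For `y ≤ 0` the term `-y Ai²` is nonnegative, so `Ai'² ≤ E(y) ≤ E(a)`. For `y ≥ 0`, `Ai'` is
negative and increasing, so its square is at most its value at `0`. -/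
lemma sq_airyAiDeriv_le_airyEnergy {a y : ℝ} (ha : a ≤ 0) (hay : a ≤ y) :
    airyAiDeriv y ^ 2 ≤ airyEnergy a := by
  have key : ∀ z, a ≤ z → z ≤ 0 → airyAiDeriv z ^ 2 ≤ airyEnergy a := fun z h1 h2 => by
    refine le_trans ?_ (antitone_airyEnergy h1)
    rw [airyEnergy]
    nlinarith [mul_nonneg (neg_nonneg.2 h2) (sq_nonneg (airyAi z))]
  rcases le_total y 0 with hy | hy
  · exact key y hay hy
  · have hmono : MonotoneOn airyAiDeriv (Ici 0) :=
      monotoneOn_of_hasDerivWithinAt_nonneg (convex_Ici 0) continuous_airyAiDeriv.continuousOn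
        (fun z _ => (hasDerivAt_airyAiDeriv z).hasDerivWithinAt) fun z hz => by
          rw [interior_Ici] at hz
          exact mul_nonneg (le_of_lt hz) (airyAi_pos_of_nonneg (le_of_lt hz)).le
    have h1 := hmono self_mem_Ici hy hy
    have h2 := airyAiDeriv_neg_of_nonneg hy
    have h3 := key 0 ha le_rfl
    nlinarith

lemma abs_airyAiDeriv_le {n : ℕ} (hn : 1 ≤ n) {y : ℝ} (hy : -airyAlpha n ≤ y) :
    |airyAiDeriv y| ≤ |airyAiDeriv (-airyAlpha n)| := by
  rw [← sq_le_sq, ← airyEnergy_neg_airyAlpha hn]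
  exact sq_airyAiDeriv_le_airyEnergy (neg_nonpos.2 (airyAlpha_nonneg n)) hy

lemma abs_airyPsi_le {n : ℕ} (hn : 1 ≤ n) {x : ℝ} (hx : 0 ≤ x) : |airyPsi n x| ≤ x := by
  have h := (convex_Ici (-airyAlpha n)).norm_image_sub_le_of_norm_hasDerivWithin_le
    (f := airyAi) (fun y _ => (hasDerivAt_airyAi y).hasDerivWithinAt)
    (fun y hy => abs_airyAiDeriv_le hn hy) self_mem_Ici
    (show x - airyAlpha n ∈ Ici (-airyAlpha n) by simp only [mem_Ici]; linarith)
  rw [airyAi_neg_airyAlpha hn, sub_zero, show x - airyAlpha n - -airyAlpha n = x by ring,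
    Real.norm_eq_abs, Real.norm_of_nonneg hx] at h
  rwa [airyPsi_eq hn, abs_div, abs_abs, div_le_iff₀' (abs_airyAiDeriv_pos hn)]

/-! ### The first moment -/

lemma integral_airyPsi_sq {n : ℕ} (hn : 1 ≤ n) : ∫ x in Ioi 0, airyPsi n x ^ 2 = 1 := by
  simp only [airyPsi_eq hn, div_pow, sq_abs]
  rw [integral_div, integral_airyAi_sub_sq, airyEnergy_neg_airyAlpha hn, div_self]
  exact pow_ne_zero 2 (airyAiDeriv_ne_zero_of_zero (airyAi_neg_airyAlpha hn))

lemma integrableOn_airyPsi_sq {n : ℕ} (hn : 1 ≤ n) :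
    IntegrableOn (fun x => airyPsi n x ^ 2) (Ioi 0) := by
  simp only [airyPsi_eq hn, div_pow]
  exact (integrableOn_airyAi_sub_sq _).div_const _

lemma continuous_airyPsi (n : ℕ) : Continuous (airyPsi n) :=
  (continuous_airyAi.comp (continuous_id.sub continuous_const)).div_const _

lemma hasDerivAt_neg_add_one_mul_exp (c x : ℝ) :
    HasDerivAt (fun x => -((x + 1) * Real.exp (c - x))) (x * Real.exp (c - x)) x := by
  have h := (((hasDerivAt_id x).add_const 1).mul ((hasDerivAt_id x).const_sub c).exp).neg
  refine h.congr_deriv ?_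
  simp
  ring

lemma tendsto_neg_add_one_mul_exp (c : ℝ) :
    Tendsto (fun x => -((x + 1) * Real.exp (c - x))) atTop (𝓝 0) := by
  have h1 := (Real.tendsto_pow_mul_exp_neg_atTop_nhds_zero 1).add
    (Real.tendsto_pow_mul_exp_neg_atTop_nhds_zero 0)
  have h := (h1.const_mul (Real.exp c)).neg
  simp only [add_zero, mul_zero, neg_zero] at h
  refine h.congr fun x => ?_
  rw [sub_eq_add_neg c, Real.exp_add]
  ring

lemma integrableOn_mul_exp_sub {a : ℝ} (ha : 0 ≤ a) (c : ℝ) :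
    IntegrableOn (fun x => x * Real.exp (c - x)) (Ioi a) :=
  integrableOn_Ioi_deriv_of_nonneg' (fun x _ => hasDerivAt_neg_add_one_mul_exp c x)
    (fun _ hx => mul_nonneg (ha.trans (le_of_lt hx)) (Real.exp_pos _).le)
    (tendsto_neg_add_one_mul_exp c)

lemma integral_mul_exp_sub {a : ℝ} (ha : 0 ≤ a) :
    ∫ x in Ioi a, x * Real.exp (a - x) = a + 1 := by
  rw [integral_Ioi_of_hasDerivAt_of_tendsto' (fun x _ => hasDerivAt_neg_add_one_mul_exp a x)
    (integrableOn_mul_exp_sub ha a) (tendsto_neg_add_one_mul_exp a)]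
  simp

lemma exists_abs_airyPsi_le_exp :
    ∃ C : ℝ, 0 ≤ C ∧ ∀ n : ℕ, 1 ≤ n → ∀ x : ℝ,
      |airyPsi n x| ≤ C * Real.exp (airyAlpha n - x) := by
  obtain ⟨C, hC⟩ := exists_abs_airyAi_le
  have hL := abs_airyAiDeriv_pos le_rfl
  refine ⟨C / |airyAiDeriv (-airyAlpha 1)|, ?_, fun n hn x => ?_⟩
  · refine div_nonneg ?_ hL.le
    simpa using (abs_nonneg _).trans (hC 0)
  · rw [airyPsi_eq hn, abs_div, abs_abs, div_mul_eq_mul_div]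
    have h := hC (x - airyAlpha n)
    rw [neg_sub] at h
    have h0 := (abs_nonneg _).trans h
    -- The normalizing constant is smallest for `n = 1`, which makes `C` independent of `n`.
    have h1 := abs_airyAiDeriv_le hn (neg_le_neg (strictMono_airyAlpha.monotone hn))
    gcongr

lemma exists_airyPsi_moment_le :
    ∃ C : ℝ, 0 ≤ C ∧ ∀ n : ℕ, 1 ≤ n →
      IntegrableOn (fun x : ℝ => |airyPsi n x| * x) (Ioi 0) ∧
      ∫ x in Ioi (0 : ℝ), |airyPsi n x| * x ≤
        airyAlpha n ^ 2 + airyAlpha n / 4 + C * (airyAlpha n + 1) := by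
  obtain ⟨C, hC0, hC⟩ := exists_abs_airyPsi_le_exp
  refine ⟨C, hC0, fun n hn => ?_⟩
  have ha := airyAlpha_nonneg n
  have hbound : ∀ x, 0 ≤ x → |airyPsi n x| * x ≤ C * (x * Real.exp (airyAlpha n - x)) :=
    fun x hx => by
      calc _ ≤ C * Real.exp (airyAlpha n - x) * x := by gcongr; exact hC n hn x
        _ = _ := by ring
  have hint : IntegrableOn (fun x : ℝ => |airyPsi n x| * x) (Ioi 0) := by
    refine ((integrableOn_mul_exp_sub le_rfl (airyAlpha n)).const_mul C).mono'
      ((continuous_airyPsi n).abs.mul continuous_id).aestronglyMeasurable ?_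
    filter_upwards [ae_restrict_mem measurableSet_Ioi] with x hx
    rw [Real.norm_of_nonneg (mul_nonneg (abs_nonneg _) (le_of_lt hx))]
    exact hbound x (le_of_lt hx)
  refine ⟨hint, ?_⟩
  have hsub1 : Ioc 0 (airyAlpha n) ⊆ Ioi 0 := Ioc_subset_Ioi_self
  have hsub2 : Ioi (airyAlpha n) ⊆ Ioi 0 := Ioi_subset_Ioi ha
  rw [← Ioc_union_Ioi_eq_Ioi ha, setIntegral_union (Ioc_disjoint_Ioi le_rfl) measurableSet_Ioi
    (hint.mono_set hsub1) (hint.mono_set hsub2)]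
  have hsq := integrableOn_airyPsi_sq hn
  have hconst : IntegrableOn (fun _ : ℝ => (1 / 4 : ℝ)) (Ioc 0 (airyAlpha n)) :=
    integrableOn_const (by simp)
  have h1 : ∫ x in Ioc 0 (airyAlpha n), |airyPsi n x| * x ≤
      airyAlpha n ^ 2 + airyAlpha n / 4 := by
    calc ∫ x in Ioc 0 (airyAlpha n), |airyPsi n x| * x
        ≤ ∫ x in Ioc 0 (airyAlpha n), (airyAlpha n ^ 2 * airyPsi n x ^ 2 + 1 / 4) := by
          refine setIntegral_mono_on (hint.mono_set hsub1)
            (((hsq.mono_set hsub1).const_mul _).add hconst) measurableSet_Ioc fun x hx => ?_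
          have := mul_le_mul_of_nonneg_left hx.2 (abs_nonneg (airyPsi n x))
          -- On `(0, αₙ]`, `x |ψ| ≤ αₙ |ψ| ≤ αₙ² ψ² + 1/4`; the first term integrates to at most
          -- `αₙ²` by normalization.
          nlinarith [sq_nonneg (airyAlpha n * |airyPsi n x| - 1 / 2), sq_abs (airyPsi n x)]
      _ = airyAlpha n ^ 2 * (∫ x in Ioc 0 (airyAlpha n), airyPsi n x ^ 2) + airyAlpha n / 4 := by
          rw [integral_add ((hsq.mono_set hsub1).const_mul _) hconst, integral_const_mul]
          simp [ha, div_eq_mul_inv]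
      _ ≤ airyAlpha n ^ 2 * 1 + airyAlpha n / 4 := by
          gcongr
          rw [← integral_airyPsi_sq hn]
          exact setIntegral_mono_set hsq (Eventually.of_forall fun x => sq_nonneg _)
            (Eventually.of_forall hsub1)
      _ = _ := by ring
  have h2 : ∫ x in Ioi (airyAlpha n), |airyPsi n x| * x ≤ C * (airyAlpha n + 1) := by
    rw [← integral_mul_exp_sub ha, ← integral_const_mul]
    exact setIntegral_mono_on (hint.mono_set hsub2)
      ((integrableOn_mul_exp_sub ha _).const_mul C) measurableSet_Ioi
      fun x hx => hbound x (ha.trans (le_of_lt hx))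
  exact add_le_add h1 h2

lemma exists_airyAlpha_le_rpow :
    ∃ M : ℝ, ∀ n : ℕ, 1 ≤ n → airyAlpha n ≤ M * (n : ℝ) ^ (2 / 3 : ℝ) := by
  obtain ⟨M, hM⟩ := tendsto_airyAlpha_mul_rpow.bddAbove_range
  refine ⟨M, fun n hn => ?_⟩
  have h := hM (mem_range_self n)
  have hn0 : (0 : ℝ) < n := by exact_mod_cast hn
  simp only [Real.rpow_neg hn0.le] at h
  rwa [← div_eq_mul_inv, div_le_iff₀ (Real.rpow_pos_of_pos hn0 _)] at h

lemma exists_airyPsi_moment_le_rpow :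
    ∃ C : ℝ, ∀ n : ℕ, 1 ≤ n →
      IntegrableOn (fun x : ℝ => |airyPsi n x| * x) (Ioi 0) ∧
      ∫ x in Ioi (0 : ℝ), |airyPsi n x| * x ≤ C * (n : ℝ) ^ (4 / 3 : ℝ) := by
  obtain ⟨C, hC0, hC⟩ := exists_airyPsi_moment_le
  obtain ⟨M, hM⟩ := exists_airyAlpha_le_rpow
  refine ⟨M ^ 2 + M / 4 + C * (M + 1), fun n hn => ⟨(hC n hn).1, (hC n hn).2.trans ?_⟩⟩
  have hn1 : (1 : ℝ) ≤ n := by exact_mod_cast hn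
  have hN : 1 ≤ (n : ℝ) ^ (2 / 3 : ℝ) := Real.one_le_rpow hn1 (by norm_num)
  have hN2 : (n : ℝ) ^ (4 / 3 : ℝ) = ((n : ℝ) ^ (2 / 3 : ℝ)) ^ 2 := by
    rw [← Real.rpow_natCast, ← Real.rpow_mul (by positivity)]
    norm_num
  have h := hM n hn
  have ha := airyAlpha_pos hn
  rw [hN2]
  generalize (n : ℝ) ^ (2 / 3 : ℝ) = N at *
  have hM0 : 0 < M := pos_of_mul_pos_left (ha.trans_le h) (by linarith)
  have hNN : N ≤ N ^ 2 := by nlinarith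
  calc airyAlpha n ^ 2 + airyAlpha n / 4 + C * (airyAlpha n + 1)
      ≤ (M * N) ^ 2 + M * N / 4 + C * (M * N + 1) := by gcongr
    -- Lower powers of `N` are absorbed into `N²`, since `N ≥ 1`.
    _ ≤ M ^ 2 * N ^ 2 + M * N ^ 2 / 4 + C * (M * N ^ 2 + N ^ 2) := by
        rw [mul_pow]
        gcongr
        linarith
    _ = _ := by ring

theorem lemma5p1 :
    -- the improper integral that defines `Ai` converges
    (∀ x : ℝ, Tendsto (airyTrunc x) atTop (𝓝 (airyAi x))) ∧
    -- the numbers `-αₙ`, `n ≥ 1`, enumerate the real zeros of `Ai` in decreasing order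
    (StrictMonoOn airyAlpha (Ici 1) ∧
      {x : ℝ | airyAi x = 0} = (fun n : ℕ => -airyAlpha n) '' Ici 1) ∧
    -- the first point
    (∀ n : ℕ, 1 ≤ n →
      MemLp (fun x : ℝ => airyAi (x - airyAlpha n)) 2 (volume.restrict (Ioi (0 : ℝ))) ∧
      DifferentiableAt ℝ airyAi (-airyAlpha n) ∧
      airyNorm n = ENNReal.ofReal |deriv airyAi (-airyAlpha n)| ∧
      HasDerivAt (airyPsi n) ((-1 : ℝ) ^ (n + 1)) 0) ∧
    -- the second point
    Tendsto (fun n : ℕ => airyAlpha n * (n : ℝ) ^ (-(2 / 3) : ℝ)) atTop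
      (𝓝 ((3 * Real.pi / 2) ^ (2 / 3 : ℝ))) ∧
    -- the third point
    (∀ n : ℕ, 1 ≤ n → ∀ x : ℝ, 0 ≤ x → |airyPsi n x| ≤ x) ∧
    -- the fourth point
    (∃ C : ℝ, ∀ n : ℕ, 1 ≤ n →
      IntegrableOn (fun x : ℝ => |airyPsi n x| * x) (Ioi 0) ∧
      ∫ x in Ioi (0 : ℝ), |airyPsi n x| * x ≤ C * (n : ℝ) ^ (4 / 3 : ℝ)) := by
  refine ⟨tendsto_airyTrunc, ⟨strictMono_airyAlpha.strictMonoOn _, airyAi_zeros_eq_image⟩,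
    fun n hn => ⟨memLp_airyAi_sub _, (hasDerivAt_airyAi _).differentiableAt, ?_,
      hasDerivAt_airyPsi_zero hn⟩, tendsto_airyAlpha_mul_rpow,
    fun n hn x hx => abs_airyPsi_le hn hx, exists_airyPsi_moment_le_rpow⟩
  rw [(hasDerivAt_airyAi _).deriv, airyNorm_eq hn]
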